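/- All graphs are finite, simple and undirected, with edge lengths $\ell:E\to[0,\infty)$, and $d_H$ denotes the shortest-path distance of a graph $H$ (equal to $\infty$ between different components). Let $G=(V,E,\ell)$ be a graph and $R\subseteq V$ a set of terminals. A distance-preserving minor of $G$ with respect to $R$, with vertex set $V'\subseteq V$, is a graph $G'=(V',E',\ell')$ such that (1) $G'$ is a minor of $G$ in which the terminals survive, i.e. $R\subseteq V'$ and there are pairwise disjoint nonempty connected sets $B_v\subseteq V$ ($v\in V'$) such that $t\in B_t$ for each $t\in R$, and for each edge $uv$ of $G'$ some edge of $G$ joins $B_u$ to $B_v$; (2) $d_{G'}(u,v)=d_G(u,v)$ for all $u,v\in R$. Theorem. There is an absolute constant $c>0$ such that for every integer $k\ge 0$ there are a graph $G=(V,E,\ell)$ and a set $R\subseteq V$ of exactly $k$ terminals with the following property: every distance-preserving minor $G'=(V',E',\ell')$ of $G$ with respect to $R$ with $V'\subseteq V$ and $$d_{G'}(u,v)\ge d_G(u,v)\qquad\text{for all }u,v\in V'$$ satisfies $|V'|\ge c\,k^4$. Moreover, $G$ can be taken to be an arrangement of segments of the following form. The terminals are $k$ points in the relative interiors of the four sides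 of the unit square, at least $\lfloor k/4\rfloor$ on each side; every terminal on the top side is joined by a straight segment to every terminal on the bottom side, and every terminal on the left side to every terminal on the right side, and no three of these segments meet in a point that is not a terminal. The vertices of $G$ are the terminals and all points of intersection of two of the segments, two vertices are adjacent if they are consecutive on one of the segments, and the length of an edge is the Euclidean distance between its ends. -/

import Mathlib

open scoped NNReal ENNReal

/-- An undirected simple graph on `V` with nonnegative edge lengths. Only the values of `len` on
edges of the graph are ever used. -/
structure LenGraph (V : Type*) where
  graph : SimpleGraph V
  len : Sym2 V → ℝ≥0

namespace LenGraph

/-- The total length of a walk. -/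
def walkLen {V : Type*} (G : LenGraph V) {u v : V} (p : G.graph.Walk u v) : ℝ≥0 :=
  (p.edges.map G.len).sum

/-- The shortest-path distance (`⊤` if there is no path). -/
noncomputable def d {V : Type*} (G : LenGraph V) (u v : V) : ℝ≥0∞ :=
  ⨅ p : G.graph.Walk u v, (G.walkLen p : ℝ≥0∞)

/-- `G'`, with vertex set `V' ⊆ V`, is a minor of `G` in which the terminals `R` survive: there are
nonempty connected pairwise disjoint branch sets `B v ⊆ V` (`v ∈ V'`), adjacent vertices of `G'` have
branch sets joined by an edge of `G`, and every terminal is a vertex of `G'` that lies in its own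
branch set. The names in `V` of the nonterminal vertices of `G'` are not restricted. -/
def IsMinor {V : Type*} (G : LenGraph V) (R : Finset V) {V' : Finset V} (G' : LenGraph V') : Prop :=
  ∃ B : V' → Set V,
    (∀ v, (G.graph.induce (B v)).Connected) ∧
    (∀ u v, u ≠ v → Disjoint (B u) (B v)) ∧
    (∀ u v, G'.graph.Adj u v → ∃ x ∈ B u, ∃ y ∈ B v, G.graph.Adj x y) ∧
    (∀ t ∈ R, ∃ h : t ∈ V', t ∈ B ⟨t, h⟩)

/-- A distance-preserving minor of `G` with respect to the terminals `R`. -/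
def IsDistPreservingMinor {V : Type*} (G : LenGraph V) (R : Finset V) {V' : Finset V}
    (G' : LenGraph V') : Prop :=
  G.IsMinor R G' ∧ ∀ u v : V', (u : V) ∈ R → (v : V) ∈ R → G'.d u v = G.d u v

/-- All distances in `G'` dominate those in `G`. -/
def Dominates {V : Type*} (G : LenGraph V) {V' : Finset V} (G' : LenGraph V') : Prop :=
  ∀ u v : V', G.d u v ≤ G'.d u v

end LenGraph

/-- The Euclidean plane. -/
abbrev Plane : Type := EuclideanSpace ℝ (Fin 2)

/-- A finite choice of points in the interiors of the four sides of the unit square, each point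
given by its coordinate along the side. -/
structure SquareSides where
  top : Finset ℝ
  bottom : Finset ℝ
  left : Finset ℝ
  right : Finset ℝ
  top_mem : ∀ x ∈ top, x ∈ Set.Ioo (0 : ℝ) 1
  bottom_mem : ∀ x ∈ bottom, x ∈ Set.Ioo (0 : ℝ) 1
  left_mem : ∀ x ∈ left, x ∈ Set.Ioo (0 : ℝ) 1
  right_mem : ∀ x ∈ right, x ∈ Set.Ioo (0 : ℝ) 1

namespace SquareSides

/-- The chosen points on the boundary of the square. -/
def terminals (S : SquareSides) : Set Plane :=
  {q | (∃ x ∈ S.top, q = !₂[x, 1]) ∨ (∃ x ∈ S.bottom, q = !₂[x, 0]) ∨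
    (∃ y ∈ S.left, q = !₂[0, y]) ∨ (∃ y ∈ S.right, q = !₂[1, y])}

/-- The lines, given by their two endpoints: every top terminal is joined to every bottom terminal,
and every left terminal to every right terminal. -/
def lines (S : SquareSides) : Set (Plane × Plane) :=
  {s | (∃ x ∈ S.top, ∃ x' ∈ S.bottom, s = (!₂[x, 1], !₂[x', 0])) ∨
    (∃ y ∈ S.left, ∃ y' ∈ S.right, s = (!₂[0, y], !₂[1, y']))}

/-- The vertices of the arrangement: terminals and points of intersection of two lines. -/
def points (S : SquareSides) : Set Plane :=
  S.terminals ∪ {q | ∃ s ∈ S.lines, ∃ t ∈ S.lines, s ≠ t ∧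
    q ∈ segment ℝ s.1 s.2 ∧ q ∈ segment ℝ t.1 t.2}

/-- No three lines meet in a point other than a terminal. -/
def GeneralPosition (S : SquareSides) : Prop :=
  ∀ s ∈ S.lines, ∀ t ∈ S.lines, ∀ r ∈ S.lines, s ≠ t → s ≠ r → t ≠ r →
    ∀ q, q ∈ segment ℝ s.1 s.2 → q ∈ segment ℝ t.1 t.2 → q ∈ segment ℝ r.1 r.2 → q ∈ S.terminals

/-- `G` with terminals `R`, drawn in the plane by `pos`, is the arrangement of the lines of `S`:
its vertices are the terminals and intersection points, its edges join vertices that are consecutive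
on some line, and the length of an edge is the Euclidean distance of its ends. -/
structure IsArrangement (S : SquareSides) {V : Type*} (G : LenGraph V) (R : Finset V)
    (pos : V → Plane) : Prop where
  injective : Function.Injective pos
  range_eq : Set.range pos = S.points
  terminals_eq : pos '' (R : Set V) = S.terminals
  adj_iff : ∀ u v, G.graph.Adj u v ↔ u ≠ v ∧
    (∃ s ∈ S.lines, pos u ∈ segment ℝ s.1 s.2 ∧ pos v ∈ segment ℝ s.1 s.2) ∧
    ∀ w, ¬ Sbtw ℝ (pos u) (pos w) (pos v)
  len_eq : ∀ u v, G.graph.Adj u v → (G.len s(u, v) : ℝ) = dist (pos u) (pos v)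

end SquareSides

/-- `G` is the arrangement graph, in general position, of the segments joining terminals on opposite
sides of the unit square, where each side carries at least `⌊|R| / 4⌋` of the terminals. -/
def IsGenericSquareArrangement {V : Type*} (G : LenGraph V) (R : Finset V) : Prop :=
  ∃ (S : SquareSides) (pos : V → Plane), S.IsArrangement G R pos ∧ S.GeneralPosition ∧
    R.card / 4 ≤ S.top.card ∧ R.card / 4 ≤ S.bottom.card ∧
    R.card / 4 ≤ S.left.card ∧ R.card / 4 ≤ S.right.card

/-!
In a minor whose distances dominate those of the arrangement, which in turn dominate the Euclidean
ones, a shortest walk between opposite terminals makes the triangle inequality an equality at each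
of its vertices, so by strict convexity all of them lie on the segment between the two terminals.
The branch sets along a top-bottom walk and those along a left-right walk have connected drawings
that cross the square in the two directions. By the Poincaré–Miranda theorem the drawings meet,
and as edges of the arrangement meet only in common ends, the two unions of branch sets share a
vertex. As branch sets are disjoint, the two walks share a vertex of the minor, which lies on both
segments and hence is their crossing point. In general position the `⌊k/4⌋ ^ 4` crossings are
distinct. General position is achieved by adding the terminals one at a time: a new terminal has
to avoid only the finitely many positions for which one of its segments passes through an existing
crossing.
-/

section PoincareMiranda

open Complex

theorem im_sub_arg_exp_eq {X : Type*} [TopologicalSpace X] [PreconnectedSpace X] {L : X → ℂ}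
    (hL : Continuous L) (hre : ∀ x, 0 ≤ (exp (L x)).re) (x y : X) :
    (L x).im - (exp (L x)).arg = (L y).im - (exp (L y)).arg := by
  have hslit (z : X) : exp (L z) ∈ slitPlane :=
    mem_slitPlane_iff.2 <| (hre z).lt_or_eq.imp id fun h him =>
      exp_ne_zero (L z) (Complex.ext h.symm him)
  have hlog : Continuous fun z => log (exp (L z)) + (L y - log (exp (L y))) :=
    (hL.cexp.clog hslit).add continuous_const
  have heq := isCoveringMap_exp.eq_of_comp_eq hL hlog
    (funext fun z => Subtype.ext <| by simp [exp_add, exp_sub, exp_log (exp_ne_zero _)]) y (by simp)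
  have him := congrArg im (congrFun heq x)
  simp only [add_im, sub_im, log_im] at him
  linarith

theorem im_sub_arg_mul_exp_eq {X : Type*} [TopologicalSpace X] [PreconnectedSpace X] {L : X → ℂ}
    {c : ℂ} (hc : c ≠ 0) (hL : Continuous L) (hre : ∀ x, 0 ≤ (c * exp (L x)).re) (x y : X) :
    (L x).im - (c * exp (L x)).arg = (L y).im - (c * exp (L y)).arg := by
  have hexp (z : X) : exp (log c + L z) = c * exp (L z) := by rw [exp_add, exp_log hc]
  have heq := im_sub_arg_exp_eq (L := fun z => log c + L z) (by fun_prop)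
    (fun z => by rw [hexp]; exact hre z) x y
  simp only [hexp, add_im] at heq
  linarith

theorem arg_I_mul_of_re_nonneg {z : ℂ} (hz : z ≠ 0) (hre : 0 ≤ z.re) :
    (I * z).arg = Real.pi / 2 + z.arg := by
  have harg := abs_le.1 (abs_arg_le_pi_div_two_iff.2 hre)
  rw [(arg_mul_eq_add_arg_iff I_ne_zero hz).2, arg_I]
  rw [arg_I]
  constructor <;> linarith [Real.pi_pos]

theorem exists_continuous_exp_eq_on_square {h : unitInterval × unitInterval → ℂ}
    (hc : Continuous h) (hne : ∀ p, h p ≠ 0) :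
    ∃ L : unitInterval × unitInterval → ℂ, Continuous L ∧ ∀ p, exp (L p) = h p := by
  let proj : ℝ × ℝ → unitInterval × unitInterval :=
    Prod.map (Set.projIcc 0 1 zero_le_one) (Set.projIcc 0 1 zero_le_one)
  have hproj : Continuous proj := by fun_prop
  obtain ⟨L, ⟨-, hL⟩, -⟩ := isCoveringMapOn_exp.existsUnique_continuousMap_lifts
    ⟨h ∘ proj, hc.comp hproj⟩ (a₀ := (0, 0)) (exp_log (hne _)) fun p => hne (proj p)
  exact ⟨fun p => L (p.1, p.2), by fun_prop, fun p => by simpa [proj] using congrFun hL (p.1, p.2)⟩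

/-- The two-dimensional Poincaré–Miranda theorem: if `h` had no zero, its argument would make a full
turn along the boundary of the square, a quarter turn per corner. -/
theorem exists_eq_zero_of_boundary_signs {h : unitInterval × unitInterval → ℂ} (hc : Continuous h)
    (hleft : ∀ s, 0 ≤ (h (s, 0)).re) (hright : ∀ s, (h (s, 1)).re ≤ 0)
    (htop : ∀ s, 0 ≤ (h (0, s)).im) (hbottom : ∀ s, (h (1, s)).im ≤ 0) : ∃ p, h p = 0 := by
  by_contra! hne
  obtain ⟨L, hL, hexp⟩ := exists_continuous_exp_eq_on_square hc hne
  have hI (n : ℕ) : I ^ n ≠ 0 := pow_ne_zero n I_ne_zero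
  have hside (n : ℕ) (γ : unitInterval → unitInterval × unitInterval) (hγ : Continuous γ)
      (hre : ∀ s, 0 ≤ (I ^ n * h (γ s)).re) :
      (L (γ 0)).im - (I ^ n * h (γ 0)).arg = (L (γ 1)).im - (I ^ n * h (γ 1)).arg := by
    simp only [← hexp] at hre ⊢
    exact im_sub_arg_mul_exp_eq (hI n) (hL.comp hγ) hre 0 1
  have hcorner (n : ℕ) (p : unitInterval × unitInterval) (hre : 0 ≤ (I ^ n * h p).re) :
      (I ^ (n + 1) * h p).arg = Real.pi / 2 + (I ^ n * h p).arg := by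
    rw [pow_succ', mul_assoc]
    exact arg_I_mul_of_re_nonneg (mul_ne_zero (hI n) (hne p)) hre
  have re₀ (s) : 0 ≤ (I ^ 0 * h (s, 0)).re := by simpa using hleft s
  have re₁ (s) : 0 ≤ (I ^ 1 * h (1, s)).re := by simpa using hbottom s
  have re₂ (s) : 0 ≤ (I ^ 2 * h (unitInterval.symm s, 1)).re := by
    simpa using hright (unitInterval.symm s)
  have re₃ (s) : 0 ≤ (I ^ 3 * h (0, unitInterval.symm s)).re := by
    simpa [I_pow_three] using htop (unitInterval.symm s)
  have side₀ := hside 0 (fun s => (s, 0)) (by fun_prop) re₀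
  have side₁ := hside 1 (fun s => (1, s)) (by fun_prop) re₁
  have side₂ := hside 2 (fun s => (unitInterval.symm s, 1)) (by fun_prop) re₂
  have side₃ := hside 3 (fun s => (0, unitInterval.symm s)) (by fun_prop) re₃
  have corner₁ := hcorner 0 _ (re₀ 1)
  have corner₂ := hcorner 1 _ (re₁ 1)
  have corner₃ := hcorner 2 _ (re₂ 1)
  have corner₄ := hcorner 3 _ (re₃ 1)
  simp only [unitInterval.symm_zero, unitInterval.symm_one, zero_add, Nat.reduceAdd,
    I_pow_four, pow_zero] at *
  linarith [Real.pi_pos]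

end PoincareMiranda

theorem plane_ext {p q : Plane} (h0 : p 0 = q 0) (h1 : p 1 = q 1) : p = q :=
  PiLp.ext (Fin.forall_fin_two.2 ⟨h0, h1⟩)

/-- The closed square `[0, 1]²`, in which the arrangements are drawn. -/
def unitSquare : Set Plane := {q | ∀ i, q i ∈ Set.Icc (0 : ℝ) 1}

theorem convex_unitSquare : Convex ℝ unitSquare :=
  fun _ hx _ hy _ _ ha hb hab i => convex_Icc (0 : ℝ) 1 (hx i) (hy i) ha hb hab

theorem inter_nonempty_of_joinedIn {X Y : Set Plane} (hX : X ⊆ unitSquare) (hY : Y ⊆ unitSquare)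
    {t b l r : Plane} (ht : t 1 = 1) (hb : b 1 = 0) (hl : l 0 = 0) (hr : r 0 = 1)
    (htb : JoinedIn X t b) (hlr : JoinedIn Y l r) : (X ∩ Y).Nonempty := by
  obtain ⟨f, hf⟩ := htb
  obtain ⟨g, hg⟩ := hlr
  let diff (p : unitInterval × unitInterval) : ℝ × ℝ := (f p.1 0 - g p.2 0, f p.1 1 - g p.2 1)
  obtain ⟨⟨s, s'⟩, hs⟩ := exists_eq_zero_of_boundary_signs
    (h := fun p => Complex.equivRealProdCLM.symm (diff p))
    (Complex.equivRealProdCLM.symm.continuous.comp (by fun_prop))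
    (fun s => by simpa [diff, hl] using (hX (hf s) 0).1)
    (fun s => by simpa [diff, hr] using (hX (hf s) 0).2)
    (fun s => by simpa [diff, ht] using (hY (hg s) 1).2)
    (fun s => by simpa [diff, hb] using (hY (hg s) 1).1)
  obtain ⟨h0, h1⟩ := Complex.ext_iff.1 hs
  have hfg : f s = g s' := plane_ext (sub_eq_zero.1 h0) (sub_eq_zero.1 h1)
  exact ⟨f s, hf s, hfg ▸ hg s'⟩

namespace LenGraph

variable {V : Type*} (G : LenGraph V)

theorem walkLen_append {u v w : V} (p : G.graph.Walk u v) (q : G.graph.Walk v w) :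
    G.walkLen (p.append q) = G.walkLen p + G.walkLen q := by
  simp [walkLen, SimpleGraph.Walk.edges_append]

theorem d_le_walkLen {u v : V} (p : G.graph.Walk u v) : G.d u v ≤ G.walkLen p :=
  iInf_le _ p

theorem d_self (u : V) : G.d u u = 0 :=
  nonpos_iff_eq_zero.1 <| by simpa [walkLen] using G.d_le_walkLen (.nil : G.graph.Walk u u)

theorem d_triangle (u v w : V) : G.d u w ≤ G.d u v + G.d v w := by
  refine ENNReal.le_iInf_add_iInf fun p q => ?_
  rw [← ENNReal.coe_add, ← walkLen_append]
  exact G.d_le_walkLen _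

theorem d_le_len {u v : V} (h : G.graph.Adj u v) : G.d u v ≤ G.len s(u, v) := by
  simpa [walkLen] using G.d_le_walkLen h.toWalk

theorem walkLen_toPath_le [DecidableEq V] {u v : V} (p : G.graph.Walk u v) :
    G.walkLen (p.toPath : G.graph.Walk u v) ≤ G.walkLen p :=
  (p.edges_bypass_sublist_edges.map G.len).sum_le_sum fun _ _ => zero_le

theorem exists_walkLen_eq_d [Finite V] {u v : V} (h : G.d u v ≠ ⊤) :
    ∃ p : G.graph.Walk u v, (G.walkLen p : ℝ≥0∞) = G.d u v := by
  classical
  have := Fintype.ofFinite V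
  obtain ⟨q₀⟩ : Nonempty (G.graph.Walk u v) := by
    by_contra! hempty
    exact h (iInf_of_empty _)
  have : Nonempty (G.graph.Path u v) := ⟨q₀.toPath⟩
  obtain ⟨p, hp⟩ := Finite.exists_min fun p : G.graph.Path u v => G.walkLen p.1
  exact ⟨p.1, le_antisymm (le_iInf fun q => ENNReal.coe_le_coe.2 <|
    (hp q.toPath).trans (G.walkLen_toPath_le q)) (G.d_le_walkLen _)⟩

theorem edist_le_d {α : Type*} [PseudoEMetricSpace α] {f : V → α}
    (hf : ∀ u v, G.graph.Adj u v → edist (f u) (f v) ≤ G.len s(u, v)) (u v : V) :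
    edist (f u) (f v) ≤ G.d u v := by
  refine le_iInf fun p => ?_
  induction p with
  | nil => simp
  | @cons u v w h p ih =>
    calc edist (f u) (f w) ≤ edist (f u) (f v) + edist (f v) (f w) := edist_triangle _ _ _
      _ ≤ G.len s(u, v) + G.walkLen p := add_le_add (hf u v h) ih
      _ = G.walkLen (.cons h p) := by simp [walkLen]

section Drawing

variable {E : Type*} [NormedAddCommGroup E] [NormedSpace ℝ E]

/-- Subdividing a segment of the drawing at all its vertices turns it into a path of edges. -/
theorem d_le_edist_of_consecutive_adj [Finite V] {f : V → E} {s : Set E} (hs : Convex ℝ s)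
    (hadj : ∀ u v, u ≠ v → f u ∈ s → f v ∈ s → (∀ w, ¬Sbtw ℝ (f u) (f w) (f v)) →
      G.graph.Adj u v)
    (hlen : ∀ u v, G.graph.Adj u v → (G.len s(u, v) : ℝ≥0∞) ≤ edist (f u) (f v)) {u v : V}
    (hu : f u ∈ s) (hv : f v ∈ s) : G.d u v ≤ edist (f u) (f v) := by
  induction hn : {w | Sbtw ℝ (f u) (f w) (f v)}.ncard using Nat.strong_induction_on
    generalizing u v with
  | _ n ih =>
    subst hn
    obtain rfl | huv := eq_or_ne u v
    · simp [d_self]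
    by_cases hbtw : ∃ w, Sbtw ℝ (f u) (f w) (f v)
    · obtain ⟨w, hw⟩ := hbtw
      have hws : f w ∈ s := hs.segment_subset hu hv hw.wbtw.mem_segment
      have hleft : {x | Sbtw ℝ (f u) (f x) (f w)} ⊂ {x | Sbtw ℝ (f u) (f x) (f v)} :=
        ⟨fun x hx => hw.wbtw.trans_sbtw_left hx, fun h => (h hw).2.2 rfl⟩
      have hright : {x | Sbtw ℝ (f w) (f x) (f v)} ⊂ {x | Sbtw ℝ (f u) (f x) (f v)} :=
        ⟨fun x hx => hw.wbtw.trans_sbtw_right hx, fun h => (h hw).2.1 rfl⟩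
      calc G.d u v ≤ G.d u w + G.d w v := G.d_triangle u w v
        _ ≤ edist (f u) (f w) + edist (f w) (f v) :=
          add_le_add (ih _ (Set.ncard_lt_ncard hleft (Set.toFinite _)) hu hws rfl)
            (ih _ (Set.ncard_lt_ncard hright (Set.toFinite _)) hws hv rfl)
        _ = edist (f u) (f v) := by
          simp only [edist_dist]
          rw [← ENNReal.ofReal_add dist_nonneg dist_nonneg, hw.wbtw.dist_add_dist]
    · exact (G.d_le_len (hadj u v huv hu hv (not_exists.1 hbtw))).trans
        (hlen u v (hadj u v huv hu hv (not_exists.1 hbtw)))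

/-- If the graph metric dominates that of a strictly convex space and the two agree on `u, v`, then
the triangle inequality is an equality at every vertex of a shortest walk from `u` to `v`. -/
theorem exists_walk_support_mem_segment [Finite V] [StrictConvexSpace ℝ E] {f : V → E}
    (hf : ∀ x y, edist (f x) (f y) ≤ G.d x y) {u v : V} (huv : G.d u v ≤ edist (f u) (f v)) :
    ∃ p : G.graph.Walk u v, ∀ w ∈ p.support, f w ∈ segment ℝ (f u) (f v) := by
  classical
  obtain ⟨p, hp⟩ := G.exists_walkLen_eq_d (huv.trans_lt (edist_lt_top _ _)).ne
  refine ⟨p, fun w hw => ?_⟩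
  have hsum : edist (f u) (f w) + edist (f w) (f v) ≤ edist (f u) (f v) :=
    calc edist (f u) (f w) + edist (f w) (f v)
      _ ≤ G.walkLen (p.takeUntil w hw) + G.walkLen (p.dropUntil w hw) :=
        add_le_add ((hf u w).trans (G.d_le_walkLen _)) ((hf w v).trans (G.d_le_walkLen _))
      _ = G.walkLen p := by rw [← ENNReal.coe_add, ← walkLen_append, p.take_spec hw]
      _ ≤ edist (f u) (f v) := hp.trans_le huv
  rw [mem_segment_iff_wbtw, ← dist_add_dist_eq_iff]
  simp only [edist_nndist, ← ENNReal.coe_add, ENNReal.coe_le_coe] at hsum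
  exact le_antisymm (mod_cast hsum) (dist_triangle _ _ _)

end Drawing

end LenGraph

section BranchSets

variable {V W : Type*} {G : SimpleGraph V} {H : SimpleGraph W} {B : W → Set V}

theorem connected_induce_iUnion_branchSets (hconn : ∀ w, (G.induce (B w)).Connected)
    (hadj : ∀ u v, H.Adj u v → ∃ x ∈ B u, ∃ y ∈ B v, G.Adj x y) {u v : W} (p : H.Walk u v) :
    (G.induce (⋃ w ∈ p.support, B w)).Connected := by
  induction p with
  | @nil u =>
    have hunion : ⋃ w ∈ (.nil : H.Walk u u).support, B w = B u := by ext; simp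
    exact hunion ▸ hconn u
  | @cons u _ _ h p ih =>
    obtain ⟨x, hx, y, hy, hxy⟩ := hadj _ _ h
    have hunion : ⋃ w ∈ (p.cons h).support, B w = B u ∪ ⋃ w ∈ p.support, B w := by ext; simp
    exact hunion ▸ SimpleGraph.connected_induce_union (hconn _).preconnected ih.preconnected hx
      (Set.mem_biUnion p.start_mem_support hy) hxy

end BranchSets

section Segments

variable {E : Type*} [AddCommGroup E] [Module ℝ E] {p e p' e' q q' : E}

theorem exists_sub_eq_smul_of_mem_segment (hq : q ∈ segment ℝ p e) (hq' : q' ∈ segment ℝ p e) :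
    ∃ r : ℝ, q - q' = r • (p - e) := by
  rw [segment_eq_image_lineMap] at hq hq'
  obtain ⟨s, -, rfl⟩ := hq
  obtain ⟨t, -, rfl⟩ := hq'
  exact ⟨t - s, by simp only [AffineMap.lineMap_apply_module]; module⟩

theorem abs_map_sub_lt_of_mem_segment {f g : E →ₗ[ℝ] ℝ} (hfg : |f (p - e)| < |g (p - e)|)
    (hq : q ∈ segment ℝ p e) (hq' : q' ∈ segment ℝ p e) (hne : q ≠ q') :
    |f (q - q')| < |g (q - q')| := by
  obtain ⟨r, hr⟩ := exists_sub_eq_smul_of_mem_segment hq hq'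
  have hr0 : r ≠ 0 := by rintro rfl; exact hne (sub_eq_zero.1 (by simpa using hr))
  rw [hr, map_smul, map_smul, smul_eq_mul, smul_eq_mul, abs_mul, abs_mul]
  gcongr

theorem eq_and_eq_of_mem_segments {f : E →ₗ[ℝ] ℝ} (hp : f p = f p') (he : f e = f e')
    (hpe : f p ≠ f e) (hqq' : q ≠ q') (hq₁ : q ∈ segment ℝ p e) (hq₂ : q ∈ segment ℝ p' e')
    (hq'₁ : q' ∈ segment ℝ p e) (hq'₂ : q' ∈ segment ℝ p' e') : p = p' ∧ e = e' := by
  have hagree {z : E} (h₁ : z ∈ segment ℝ p e) (h₂ : z ∈ segment ℝ p' e') :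
      ∃ t : ℝ, z = AffineMap.lineMap p e t ∧ z = AffineMap.lineMap p' e' t := by
    rw [segment_eq_image_lineMap] at h₁ h₂
    obtain ⟨t, -, rfl⟩ := h₁
    obtain ⟨s, -, hs⟩ := h₂
    have hts : s = t := by
      have := congrArg f hs
      simp only [AffineMap.lineMap_apply_module', map_add, map_smul, map_sub, smul_eq_mul, ← hp,
        ← he, add_left_inj] at this
      exact mul_right_cancel₀ (sub_ne_zero.2 hpe.symm) this
    exact ⟨t, rfl, hts ▸ hs.symm⟩
  obtain ⟨t, ht, ht'⟩ := hagree hq₁ hq₂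
  obtain ⟨s, hs, hs'⟩ := hagree hq'₁ hq'₂
  have hst : s - t ≠ 0 := sub_ne_zero.2 <| by rintro rfl; exact hqq' (ht.trans hs.symm)
  have ht0 := ht.symm.trans ht'
  have hs0 := hs.symm.trans hs'
  simp only [AffineMap.lineMap_apply_module] at ht0 hs0
  constructor <;> refine smul_right_injective E hst ?_ <;> beta_reduce
  · linear_combination (norm := module) s • ht0 - t • hs0
  · linear_combination (norm := module) (1 - t) • hs0 - (1 - s) • ht0

theorem exists_end_mem_uIcc {α : Type*} [LinearOrder α] {a b c d t : α} (h : t ∈ Set.uIcc a b)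
    (h' : t ∈ Set.uIcc c d) :
    a ∈ Set.uIcc c d ∨ b ∈ Set.uIcc c d ∨ c ∈ Set.uIcc a b ∨ d ∈ Set.uIcc a b := by
  simp only [Set.mem_uIcc] at *
  by_contra! hcon
  rcases h with h | h <;> rcases h' with h' | h' <;> grind

theorem exists_end_mem_segment {a b c d z : E} (hpe : p ≠ e) (ha : a ∈ segment ℝ p e)
    (hb : b ∈ segment ℝ p e) (hc : c ∈ segment ℝ p e) (hd : d ∈ segment ℝ p e)
    (hz : z ∈ segment ℝ a b) (hz' : z ∈ segment ℝ c d) :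
    a ∈ segment ℝ c d ∨ b ∈ segment ℝ c d ∨ c ∈ segment ℝ a b ∨ d ∈ segment ℝ a b := by
  rw [segment_eq_image_lineMap] at ha hb hc hd
  obtain ⟨ta, -, rfl⟩ := ha
  obtain ⟨tb, -, rfl⟩ := hb
  obtain ⟨tc, -, rfl⟩ := hc
  obtain ⟨td, -, rfl⟩ := hd
  have hinj := AffineMap.lineMap_injective ℝ hpe
  simp only [← image_segment, segment_eq_uIcc] at hz hz' ⊢
  obtain ⟨t, ht, rfl⟩ := hz
  obtain ⟨t', ht', heq⟩ := hz'
  obtain rfl := hinj heq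
  simpa only [hinj.mem_set_image] using exists_end_mem_uIcc ht ht'

end Segments

/-- The part of the straight-line drawing of a graph that is spanned by a set of vertices. -/
def straightLineDrawing {V E : Type*} [AddCommGroup E] [Module ℝ E] (G : SimpleGraph V)
    (pos : V → E) (X : Set V) : Set E :=
  {z | ∃ x ∈ X, ∃ y ∈ X, (x = y ∨ G.Adj x y) ∧ z ∈ segment ℝ (pos x) (pos y)}

section StraightLineDrawing

variable {V E : Type*} {G : SimpleGraph V} {pos : V → E} {X : Set V}

theorem straightLineDrawing_subset [AddCommGroup E] [Module ℝ E] {s : Set E} (hs : Convex ℝ s)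
    (hpos : ∀ x ∈ X, pos x ∈ s) : straightLineDrawing G pos X ⊆ s := by
  rintro z ⟨x, hx, y, hy, -, hz⟩
  exact hs.segment_subset (hpos x hx) (hpos y hy) hz

theorem joinedIn_straightLineDrawing [AddCommGroup E] [Module ℝ E] [TopologicalSpace E]
    [ContinuousAdd E] [ContinuousSMul ℝ E] (hX : (G.induce X).Connected) {x y : V} (hx : x ∈ X)
    (hy : y ∈ X) : JoinedIn (straightLineDrawing G pos X) (pos x) (pos y) := by
  obtain ⟨p⟩ := hX.preconnected ⟨x, hx⟩ ⟨y, hy⟩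
  suffices ∀ {u v : X}, (G.induce X).Walk u v →
      JoinedIn (straightLineDrawing G pos X) (pos u) (pos v) from this p
  intro u v p
  induction p with
  | @nil u => exact .refl ⟨u, u.2, u, u.2, .inl rfl, left_mem_segment ℝ _ _⟩
  | @cons u v _ h _ ih =>
    exact .trans (.of_segment_subset fun z hz => ⟨u, u.2, v, v.2, .inr h, hz⟩) ih

end StraightLineDrawing

namespace SquareSides

/-- The sides of the unit square, so that statements about them need no fourfold repetition. -/
inductive Side
  | top
  | bottom
  | left
  | right
  deriving DecidableEq

namespace Side

instance : Fintype Side :=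
  ⟨{top, bottom, left, right}, by rintro ⟨⟩ <;> simp⟩

theorem sum_univ {M : Type*} [AddCommMonoid M] (f : Side → M) :
    ∑ i, f i = f top + (f bottom + (f left + f right)) := by
  change ∑ i ∈ {top, bottom, left, right}, f i = _
  simp

/-- The opposite side of the square. -/
def opposite : Side → Side
  | top => bottom
  | bottom => top
  | left => right
  | right => left

/-- The index of the coordinate that is constant on a side. -/
def axis : Side → Fin 2
  | top | bottom => 1
  | left | right => 0

/-- The point of a side with a given coordinate along the side. -/
noncomputable def point : Side → ℝ → Plane
  | top, x => !₂[x, 1]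
  | bottom, x => !₂[x, 0]
  | left, y => !₂[0, y]
  | right, y => !₂[1, y]

theorem opposite_opposite (i : Side) : i.opposite.opposite = i := by
  cases i <;> rfl

theorem opposite_ne (i : Side) : i.opposite ≠ i := by
  cases i <;> simp [opposite]

theorem axis_opposite (i : Side) : i.opposite.axis = i.axis := by
  cases i <;> rfl

theorem point_axis_eq (i : Side) (x y : ℝ) : i.point x i.axis = i.point y i.axis := by
  cases i <;> rfl

theorem point_apply_of_ne {i : Side} {j : Fin 2} (hj : j ≠ i.axis) (x : ℝ) : i.point x j = x := by
  cases i <;> fin_cases j <;> simp_all [axis, point]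

theorem abs_point_axis_sub (i : Side) (x y : ℝ) :
    |i.point x i.axis - i.opposite.point y i.axis| = 1 := by
  cases i <;> simp [axis, point, opposite]

theorem point_axis_ne (i : Side) (x y : ℝ) : i.point x i.axis ≠ i.opposite.point y i.axis :=
  fun h => by simpa [h] using i.abs_point_axis_sub x y

theorem point_injective (i : Side) : Function.Injective i.point := by
  cases i <;> intro x y h <;> simpa [point] using h

theorem eq_of_point_eq {i j : Side} {x y : ℝ} (hx : x ∈ Set.Ioo (0 : ℝ) 1)
    (h : i.point x = j.point y) : i = j := by
  cases i <;> cases j <;> simp_all [point]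

theorem point_axis_notMem_Ioo (i : Side) (x : ℝ) : i.point x i.axis ∉ Set.Ioo (0 : ℝ) 1 := by
  cases i <;> simp [axis, point]

theorem point_mem_unitSquare (i : Side) {x : ℝ} (hx : x ∈ Set.Ioo (0 : ℝ) 1) :
    i.point x ∈ unitSquare := by
  cases i <;> simp [unitSquare, point, Fin.forall_fin_two, hx.1.le, hx.2.le]

end Side

variable (S : SquareSides)

/-- The coordinates of the chosen points on a side. -/
def side : Side → Finset ℝ
  | .top => S.top
  | .bottom => S.bottom
  | .left => S.left
  | .right => S.right

/-- The lines from the terminals on a side to those on the opposite side. -/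
def linesFrom (i : Side) : Set (Plane × Plane) :=
  {s | ∃ x ∈ S.side i, ∃ y ∈ S.side i.opposite, s = (i.point x, i.opposite.point y)}

theorem mem_Ioo_of_mem_side {i : Side} {x : ℝ} (hx : x ∈ S.side i) : x ∈ Set.Ioo (0 : ℝ) 1 := by
  cases i
  exacts [S.top_mem x hx, S.bottom_mem x hx, S.left_mem x hx, S.right_mem x hx]

theorem exists_side_eq {f : Side → Finset ℝ} (hf : ∀ i, ∀ x ∈ f i, x ∈ Set.Ioo (0 : ℝ) 1) :
    ∃ T : SquareSides, T.side = f :=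
  ⟨⟨f .top, f .bottom, f .left, f .right, hf _, hf _, hf _, hf _⟩, by ext i : 1; cases i <;> rfl⟩

theorem mem_terminals {q : Plane} : q ∈ S.terminals ↔ ∃ i, ∃ x ∈ S.side i, i.point x = q := by
  constructor
  · rintro (⟨x, hx, rfl⟩ | ⟨x, hx, rfl⟩ | ⟨x, hx, rfl⟩ | ⟨x, hx, rfl⟩)
    exacts [⟨.top, x, hx, rfl⟩, ⟨.bottom, x, hx, rfl⟩, ⟨.left, x, hx, rfl⟩, ⟨.right, x, hx, rfl⟩]
  · rintro ⟨i, x, hx, rfl⟩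
    cases i
    exacts [.inl ⟨x, hx, rfl⟩, .inr (.inl ⟨x, hx, rfl⟩), .inr (.inr (.inl ⟨x, hx, rfl⟩)),
      .inr (.inr (.inr ⟨x, hx, rfl⟩))]

theorem lines_eq_union : S.lines = S.linesFrom .top ∪ S.linesFrom .left :=
  rfl

theorem point_mem_terminals {i : Side} {x : ℝ} (hx : x ∈ S.side i) : i.point x ∈ S.terminals :=
  S.mem_terminals.2 ⟨i, x, hx, rfl⟩

theorem terminals_eq_image : S.terminals =
    (fun p : Σ _ : Side, ℝ => p.1.point p.2) '' (Finset.univ.sigma S.side) := by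
  ext q
  simp [mem_terminals]

theorem finite_terminals : S.terminals.Finite :=
  S.terminals_eq_image ▸ (Finset.finite_toSet _).image _

theorem ncard_terminals : S.terminals.ncard = ∑ i, (S.side i).card := by
  rw [terminals_eq_image, Set.InjOn.ncard_image, Set.ncard_coe_finset, Finset.card_sigma]
  rintro ⟨i, x⟩ hx ⟨j, y⟩ - h
  obtain rfl := Side.eq_of_point_eq (S.mem_Ioo_of_mem_side (Finset.mem_sigma.1 hx).2) h
  obtain rfl := i.point_injective h
  rfl

theorem ncard_linesFrom (i : Side) :
    (S.linesFrom i).ncard = (S.side i).card * (S.side i.opposite).card := by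
  rw [← Finset.card_product, ← Set.ncard_coe_finset, ← Set.ncard_image_of_injective _
    (i.point_injective.prodMap i.opposite.point_injective)]
  congr 1
  ext s
  simp [linesFrom, Prod.ext_iff, eq_comm, and_assoc]

variable {S}

theorem mem_Ioo_of_mem_linesFrom {i : Side} {s : Plane × Plane} (hs : s ∈ S.linesFrom i) {q : Plane}
    (hq : q ∈ segment ℝ s.1 s.2) {j : Fin 2} (hj : j ≠ i.axis) : q j ∈ Set.Ioo (0 : ℝ) 1 := by
  obtain ⟨x, hx, y, hy, rfl⟩ := hs
  obtain ⟨a, b, ha, hb, hab, rfl⟩ := hq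
  have hxj : i.point x j ∈ Set.Ioo (0 : ℝ) 1 := by
    rw [Side.point_apply_of_ne hj]
    exact S.mem_Ioo_of_mem_side hx
  have hyj : i.opposite.point y j ∈ Set.Ioo (0 : ℝ) 1 := by
    rw [Side.point_apply_of_ne (i.axis_opposite.symm ▸ hj)]
    exact S.mem_Ioo_of_mem_side hy
  exact convex_Ioo 0 1 hxj hyj ha hb hab

theorem abs_sub_lt_of_mem_linesFrom {i : Side} {s : Plane × Plane} (hs : s ∈ S.linesFrom i)
    {q q' : Plane} (hq : q ∈ segment ℝ s.1 s.2) (hq' : q' ∈ segment ℝ s.1 s.2) (hne : q ≠ q')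
    {j : Fin 2} (hj : j ≠ i.axis) : |q j - q' j| < |q i.axis - q' i.axis| := by
  refine abs_map_sub_lt_of_mem_segment (f := (EuclideanSpace.proj j).toLinearMap)
    (g := (EuclideanSpace.proj i.axis).toLinearMap) ?_ hq hq' hne
  have hfst := mem_Ioo_of_mem_linesFrom hs (left_mem_segment ℝ _ _) hj
  have hsnd := mem_Ioo_of_mem_linesFrom hs (right_mem_segment ℝ _ _) hj
  obtain ⟨x, -, y, -, rfl⟩ := hs
  calc |i.point x j - i.opposite.point y j| < 1 :=
        abs_lt.2 ⟨by linarith [hfst.1, hsnd.2], by linarith [hfst.2, hsnd.1]⟩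
    _ = |i.point x i.axis - i.opposite.point y i.axis| := (i.abs_point_axis_sub x y).symm

theorem eq_of_mem_linesFrom_of_mem_linesFrom {i : Side} {s t : Plane × Plane}
    (hs : s ∈ S.linesFrom i) (ht : t ∈ S.linesFrom i) (hst : s ≠ t) {q q' : Plane}
    (hqs : q ∈ segment ℝ s.1 s.2) (hqt : q ∈ segment ℝ t.1 t.2)
    (hqs' : q' ∈ segment ℝ s.1 s.2) (hqt' : q' ∈ segment ℝ t.1 t.2) : q = q' := by
  by_contra hne
  obtain ⟨x, -, y, -, rfl⟩ := hs
  obtain ⟨x', -, y', -, rfl⟩ := ht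
  have haxis : i.opposite.point y i.axis = i.opposite.point y' i.axis :=
    i.axis_opposite ▸ i.opposite.point_axis_eq y y'
  exact hst <| Prod.ext_iff.2 <|
    eq_and_eq_of_mem_segments (f := (EuclideanSpace.proj i.axis).toLinearMap)
      (i.point_axis_eq x x') haxis (i.point_axis_ne x y) hne hqs hqt hqs' hqt'

theorem eq_of_mem_top_of_mem_left {s t : Plane × Plane} (hs : s ∈ S.linesFrom .top)
    (ht : t ∈ S.linesFrom .left) {q q' : Plane}
    (hqs : q ∈ segment ℝ s.1 s.2) (hqt : q ∈ segment ℝ t.1 t.2)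
    (hqs' : q' ∈ segment ℝ s.1 s.2) (hqt' : q' ∈ segment ℝ t.1 t.2) : q = q' := by
  by_contra hne
  exact lt_asymm (abs_sub_lt_of_mem_linesFrom hs hqs hqs' hne (j := 0) (by simp [Side.axis]))
    (abs_sub_lt_of_mem_linesFrom ht hqt hqt' hne (j := 1) (by simp [Side.axis]))

theorem eq_of_mem_lines_of_mem_lines {s t : Plane × Plane} (hs : s ∈ S.lines) (ht : t ∈ S.lines)
    (hst : s ≠ t) {q q' : Plane}
    (hqs : q ∈ segment ℝ s.1 s.2) (hqt : q ∈ segment ℝ t.1 t.2)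
    (hqs' : q' ∈ segment ℝ s.1 s.2) (hqt' : q' ∈ segment ℝ t.1 t.2) : q = q' := by
  rw [lines_eq_union] at hs ht
  rcases hs with hs | hs <;> rcases ht with ht | ht
  · exact eq_of_mem_linesFrom_of_mem_linesFrom hs ht hst hqs hqt hqs' hqt'
  · exact eq_of_mem_top_of_mem_left hs ht hqs hqt hqs' hqt'
  · exact eq_of_mem_top_of_mem_left ht hs hqt hqs hqt' hqs'
  · exact eq_of_mem_linesFrom_of_mem_linesFrom hs ht hst hqs hqt hqs' hqt'

theorem exists_linesFrom_of_mem_lines {s : Plane × Plane} (hs : s ∈ S.lines) :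
    ∃ i, s ∈ S.linesFrom i := by
  rw [lines_eq_union] at hs
  exact hs.elim (fun h => ⟨_, h⟩) fun h => ⟨_, h⟩

theorem fst_mem_terminals {s : Plane × Plane} (hs : s ∈ S.lines) : s.1 ∈ S.terminals := by
  obtain ⟨i, x, hx, y, -, rfl⟩ := exists_linesFrom_of_mem_lines hs
  exact S.point_mem_terminals hx

theorem snd_mem_terminals {s : Plane × Plane} (hs : s ∈ S.lines) : s.2 ∈ S.terminals := by
  obtain ⟨i, x, -, y, hy, rfl⟩ := exists_linesFrom_of_mem_lines hs
  exact S.point_mem_terminals hy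

theorem fst_ne_snd {s : Plane × Plane} (hs : s ∈ S.lines) : s.1 ≠ s.2 := by
  obtain ⟨i, x, -, y, -, rfl⟩ := exists_linesFrom_of_mem_lines hs
  exact fun h => i.point_axis_ne x y (congrArg (fun q : Plane => q i.axis) h)

theorem terminals_subset_unitSquare : S.terminals ⊆ unitSquare := by
  intro q hq
  obtain ⟨i, x, hx, rfl⟩ := S.mem_terminals.1 hq
  exact i.point_mem_unitSquare (S.mem_Ioo_of_mem_side hx)

theorem points_subset_unitSquare : S.points ⊆ unitSquare := by
  rintro q (hq | ⟨s, hs, -, -, -, hqs, -⟩)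
  · exact terminals_subset_unitSquare hq
  · exact convex_unitSquare.segment_subset (terminals_subset_unitSquare (fst_mem_terminals hs))
      (terminals_subset_unitSquare (snd_mem_terminals hs)) hqs

theorem notMem_terminals {q : Plane} (hq : ∀ i, q i ∈ Set.Ioo (0 : ℝ) 1) : q ∉ S.terminals := by
  rw [mem_terminals]
  rintro ⟨i, x, -, rfl⟩
  exact i.point_axis_notMem_Ioo x (hq i.axis)

theorem notMem_terminals_of_mem_crossing {s t : Plane × Plane} (hs : s ∈ S.linesFrom .top)
    (ht : t ∈ S.linesFrom .left) {q : Plane} (hqs : q ∈ segment ℝ s.1 s.2)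
    (hqt : q ∈ segment ℝ t.1 t.2) : q ∉ S.terminals :=
  notMem_terminals <| Fin.forall_fin_two.2
    ⟨mem_Ioo_of_mem_linesFrom hs hqs (by simp [Side.axis]),
      mem_Ioo_of_mem_linesFrom ht hqt (by simp [Side.axis])⟩

variable (S) in
theorem finite_lines : S.lines.Finite :=
  (S.finite_terminals.prod S.finite_terminals).subset fun _ hs =>
    ⟨fst_mem_terminals hs, snd_mem_terminals hs⟩

variable (S) in
theorem finite_points : S.points.Finite := by
  refine S.finite_terminals.union <| Set.Finite.subset
    (s := ⋃ s ∈ S.lines, ⋃ t ∈ S.lines, {q | s ≠ t ∧ q ∈ segment ℝ s.1 s.2 ∧ q ∈ segment ℝ t.1 t.2})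
    (S.finite_lines.biUnion fun s hs => S.finite_lines.biUnion fun t ht => ?_) ?_
  · exact Set.Subsingleton.finite fun q hq q' hq' =>
      eq_of_mem_lines_of_mem_lines hs ht hq.1 hq.2.1 hq.2.2 hq'.2.1 hq'.2.2
  · rintro q ⟨s, hs, t, ht, hq⟩
    exact Set.mem_biUnion hs (Set.mem_biUnion ht hq)

theorem GeneralPosition.of_empty (hS : S.terminals = ∅) : S.GeneralPosition := by
  intro s hs
  exact absurd (fst_mem_terminals hs) (hS ▸ Set.notMem_empty _)

/-- The new lines all pass through the new terminal `p`, so any two of them meet only there. -/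
theorem GeneralPosition.of_new_terminal {T : SquareSides} (hS : S.GeneralPosition)
    (hST : S.terminals ⊆ T.terminals) {p : Plane} (hp : p ∈ T.terminals)
    (hnew : ∀ s ∈ T.lines, s ∈ S.lines ∨
      p ∈ segment ℝ s.1 s.2 ∧ ∀ q ∈ S.points, q ∈ segment ℝ s.1 s.2 → q ∈ S.terminals) :
    T.GeneralPosition := by
  have two_new {s t : Plane × Plane} (hs : s ∈ T.lines) (ht : t ∈ T.lines) (hst : s ≠ t)
      (hps : p ∈ segment ℝ s.1 s.2) (hpt : p ∈ segment ℝ t.1 t.2) {q : Plane}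
      (hqs : q ∈ segment ℝ s.1 s.2) (hqt : q ∈ segment ℝ t.1 t.2) : q ∈ T.terminals :=
    eq_of_mem_lines_of_mem_lines hs ht hst hps hpt hqs hqt ▸ hp
  intro s hs t ht r hr hst hsr htr q hqs hqt hqr
  have crossing {s t : Plane × Plane} (hs : s ∈ S.lines) (ht : t ∈ S.lines) (hst : s ≠ t)
      (hqs : q ∈ segment ℝ s.1 s.2) (hqt : q ∈ segment ℝ t.1 t.2) : q ∈ S.points :=
    .inr ⟨s, hs, t, ht, hst, hqs, hqt⟩
  rcases hnew s hs with hs' | ⟨hps, hs'⟩ <;> rcases hnew t ht with ht' | ⟨hpt, ht'⟩ <;>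
    rcases hnew r hr with hr' | ⟨hpr, hr'⟩
  · exact hST (hS s hs' t ht' r hr' hst hsr htr q hqs hqt hqr)
  · exact hST (hr' q (crossing hs' ht' hst hqs hqt) hqr)
  · exact hST (ht' q (crossing hs' hr' hsr hqs hqr) hqt)
  · exact two_new ht hr htr hpt hpr hqt hqr
  · exact hST (hs' q (crossing ht' hr' htr hqt hqr) hqs)
  · exact two_new hs hr hsr hps hpr hqs hqr
  · exact two_new hs ht hst hps hpt hqs hqt
  · exact two_new hs ht hst hps hpt hqs hqt

/-- A line is determined by its end on the opposite side and one further point. -/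
theorem finite_setOf_mem_segment (i : Side) {y : ℝ} {q : Plane} (hq : q ≠ i.opposite.point y) :
    {z | q ∈ segment ℝ (i.point z) (i.opposite.point y)}.Finite :=
  Set.Subsingleton.finite fun z hz z' hz' => i.point_injective <| And.left <|
    eq_and_eq_of_mem_segments (f := (EuclideanSpace.proj i.axis).toLinearMap)
      (i.point_axis_eq z z') rfl (i.point_axis_ne z y) hq hz hz'
      (right_mem_segment ℝ _ _) (right_mem_segment ℝ _ _)

theorem exists_generic_coord (S : SquareSides) (i : Side) : ∃ z ∈ Set.Ioo (0 : ℝ) 1, z ∉ S.side i ∧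
    ∀ y ∈ S.side i.opposite, ∀ q ∈ S.points, q ∈ segment ℝ (i.point z) (i.opposite.point y) →
      q ∈ S.terminals := by
  have hbad : (⋃ y ∈ S.side i.opposite, ⋃ q ∈ S.points \ S.terminals,
      {z | q ∈ segment ℝ (i.point z) (i.opposite.point y)}).Finite := by
    refine (S.side i.opposite).finite_toSet.biUnion fun y hy =>
      S.finite_points.sdiff.biUnion fun q hq => finite_setOf_mem_segment i ?_
    rintro rfl
    exact hq.2 (S.point_mem_terminals hy)
  obtain ⟨z, hz, hgood⟩ := ((Set.Ioo_infinite (zero_lt_one (α := ℝ))).sdiff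
    ((S.side i).finite_toSet.union hbad)).nonempty
  refine ⟨z, hz, fun h => hgood (.inl h), fun y hy q hq hqz => ?_⟩
  by_contra hterm
  exact hgood (.inr (Set.mem_biUnion hy (Set.mem_biUnion ⟨hq, hterm⟩ hqz)))

theorem mem_lines_of_side_eq_update {T : SquareSides} {i : Side} {z : ℝ}
    (hT : T.side = Function.update S.side i (insert z (S.side i))) {s : Plane × Plane}
    (hs : s ∈ T.lines) : s ∈ S.lines ∨ ∃ y ∈ S.side i.opposite,
      s = (i.point z, i.opposite.point y) ∨ s = (i.opposite.point y, i.point z) := by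
  have hside {j : Side} {x : ℝ} (hx : x ∈ T.side j) : x ∈ S.side j ∨ j = i ∧ x = z := by
    obtain rfl | hj := eq_or_ne j i
    · simpa [hT, or_comm] using hx
    · simpa [hT, hj] using hx
  have hfrom {j : Side} (hs : s ∈ T.linesFrom j) : s ∈ S.linesFrom j ∨
      ∃ y ∈ S.side i.opposite,
        s = (i.point z, i.opposite.point y) ∨ s = (i.opposite.point y, i.point z) := by
    obtain ⟨x, hx, y, hy, rfl⟩ := hs
    rcases hside hx with hx | ⟨rfl, rfl⟩
    · rcases hside hy with hy | ⟨rfl, rfl⟩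
      · exact .inl ⟨x, hx, y, hy, rfl⟩
      · rw [Side.opposite_opposite]
        exact .inr ⟨x, hx, .inr rfl⟩
    · exact .inr ⟨y, (hside hy).resolve_right fun h => j.opposite_ne h.1, .inl rfl⟩
  rw [lines_eq_union] at hs ⊢
  exact hs.elim (fun h => (hfrom h).imp_left .inl) fun h => (hfrom h).imp_left .inr

theorem GeneralPosition.exists_insert (hS : S.GeneralPosition) (i : Side) :
    ∃ T : SquareSides, T.GeneralPosition ∧
      ∀ j, (T.side j).card = (S.side j).card + if j = i then 1 else 0 := by
  obtain ⟨z, hz, hzS, hgen⟩ := S.exists_generic_coord i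
  obtain ⟨T, hT⟩ := exists_side_eq (f := Function.update S.side i (insert z (S.side i))) <| by
    intro j x hx
    obtain rfl | hj := eq_or_ne j i
    · obtain rfl | hx := Finset.mem_insert.1 (by simpa using hx)
      exacts [hz, S.mem_Ioo_of_mem_side hx]
    · exact S.mem_Ioo_of_mem_side (by simpa [hj] using hx)
  refine ⟨T, hS.of_new_terminal (p := i.point z) ?_ (T.point_mem_terminals (by simp [hT])) ?_, ?_⟩
  · intro q hq
    obtain ⟨j, x, hx, rfl⟩ := S.mem_terminals.1 hq
    refine T.point_mem_terminals ?_
    obtain rfl | hj := eq_or_ne j i <;> simp_all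
  · intro s hs
    obtain h | ⟨y, hy, rfl | rfl⟩ := mem_lines_of_side_eq_update hT hs
    · exact .inl h
    · exact .inr ⟨left_mem_segment ℝ _ _, hgen y hy⟩
    · exact .inr ⟨right_mem_segment ℝ _ _, fun q hq h =>
        hgen y hy q hq (by rwa [segment_symm] at h)⟩
  · intro j
    obtain rfl | hj := eq_or_ne j i <;> simp_all

theorem exists_generalPosition (n : Side → ℕ) :
    ∃ S : SquareSides, S.GeneralPosition ∧ ∀ i, (S.side i).card = n i := by
  induction hk : ∑ i, n i generalizing n with
  | zero =>
    obtain ⟨S, hS⟩ := exists_side_eq (f := fun _ => ∅) (by simp)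
    have hn : ∀ i, n i = 0 := by simpa using hk
    refine ⟨S, .of_empty ?_, by simp [hS, hn]⟩
    ext q
    simp [mem_terminals, hS]
  | succ k ih =>
    obtain ⟨i, -, hi⟩ := Finset.exists_ne_zero_of_sum_ne_zero (hk.trans_ne k.succ_ne_zero)
    obtain ⟨S, hS, hcard⟩ := ih (Function.update n i (n i - 1)) (by
      rw [Finset.sum_update_of_mem (Finset.mem_univ i)]
      rw [← Finset.add_sum_erase _ n (Finset.mem_univ i), ← Finset.sdiff_singleton_eq_erase] at hk
      omega)
    obtain ⟨T, hT, hcard'⟩ := hS.exists_insert i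
    refine ⟨T, hT, fun j => ?_⟩
    rw [hcard', hcard]
    obtain rfl | hj := eq_or_ne j i
    · simpa using Nat.sub_add_cancel (Nat.one_le_iff_ne_zero.2 hi)
    · simp [hj]

/-- The arrangement graph of the lines of `S`; its vertices are the points themselves. -/
noncomputable def arrangement (S : SquareSides) : LenGraph S.points where
  graph :=
    { Adj := fun u v => u ≠ v ∧
        (∃ s ∈ S.lines, (u : Plane) ∈ segment ℝ s.1 s.2 ∧ (v : Plane) ∈ segment ℝ s.1 s.2) ∧
        ∀ w : S.points, ¬Sbtw ℝ (u : Plane) w v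
      symm := ⟨fun _ _ ⟨hne, ⟨s, hs, hu, hv⟩, hbtw⟩ =>
        ⟨hne.symm, ⟨s, hs, hv, hu⟩, fun w hw => hbtw w (sbtw_comm.1 hw)⟩⟩
      loopless := ⟨fun _ h => h.1 rfl⟩ }
  len := Sym2.lift ⟨fun u v => nndist (u : Plane) v, fun _ _ => nndist_comm _ _⟩

/-- The terminals of `S`, as vertices of its arrangement graph. -/
noncomputable def terminalPoints (S : SquareSides) : Finset S.points :=
  (S.finite_terminals.preimage Subtype.val_injective.injOn).toFinset

theorem isArrangement_arrangement (S : SquareSides) :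
    S.IsArrangement S.arrangement S.terminalPoints Subtype.val where
  injective := Subtype.val_injective
  range_eq := Subtype.range_val
  terminals_eq := by
    rw [terminalPoints, Set.Finite.coe_toFinset, Subtype.image_preimage_coe, points]
    exact Set.inter_eq_right.2 Set.subset_union_left
  adj_iff _ _ := Iff.rfl
  len_eq _ _ _ := rfl

theorem ne_of_mem_top_of_mem_left {s t : Plane × Plane} (hs : s ∈ S.linesFrom .top)
    (ht : t ∈ S.linesFrom .left) : s ≠ t := by
  rintro rfl
  exact notMem_terminals_of_mem_crossing hs ht (left_mem_segment ℝ _ _) (left_mem_segment ℝ _ _)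
    (fst_mem_terminals (.inr ht))

theorem GeneralPosition.eq_of_mem_segment (hS : S.GeneralPosition) {s t r : Plane × Plane}
    (hs : s ∈ S.lines) (ht : t ∈ S.lines) (hr : r ∈ S.lines) (hsr : s ≠ r) (htr : t ≠ r) {q : Plane}
    (hq : q ∉ S.terminals) (hqs : q ∈ segment ℝ s.1 s.2) (hqt : q ∈ segment ℝ t.1 t.2)
    (hqr : q ∈ segment ℝ r.1 r.2) : s = t := by
  by_contra hst
  exact hq (hS s hs t ht r hr hst hsr htr q hqs hqt hqr)

theorem GeneralPosition.eq_of_mem_crossings (hS : S.GeneralPosition) {s s' t t' : Plane × Plane}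
    (hs : s ∈ S.linesFrom .top) (hs' : s' ∈ S.linesFrom .top) (ht : t ∈ S.linesFrom .left)
    (ht' : t' ∈ S.linesFrom .left) {q : Plane}
    (hqs : q ∈ segment ℝ s.1 s.2) (hqs' : q ∈ segment ℝ s'.1 s'.2)
    (hqt : q ∈ segment ℝ t.1 t.2) (hqt' : q ∈ segment ℝ t'.1 t'.2) : s = s' ∧ t = t' := by
  have hq := notMem_terminals_of_mem_crossing hs ht hqs hqt
  exact ⟨hS.eq_of_mem_segment (.inl hs) (.inl hs') (.inr ht) (ne_of_mem_top_of_mem_left hs ht)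
      (ne_of_mem_top_of_mem_left hs' ht) hq hqs hqs' hqt,
    hS.eq_of_mem_segment (.inr ht) (.inr ht') (.inl hs) (ne_of_mem_top_of_mem_left hs ht).symm
      (ne_of_mem_top_of_mem_left hs ht').symm hq hqt hqt' hqs⟩

namespace IsArrangement

variable {V : Type*} {G : LenGraph V} {R : Finset V} {pos : V → Plane}
  (hA : S.IsArrangement G R pos)

include hA

theorem card_eq_sum : R.card = ∑ i, (S.side i).card := by
  rw [← S.ncard_terminals, ← hA.terminals_eq, Set.ncard_image_of_injective _ hA.injective,
    Set.ncard_coe_finset]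

theorem pos_mem_points (v : V) : pos v ∈ S.points :=
  hA.range_eq ▸ Set.mem_range_self v

theorem finite : Finite V :=
  Set.finite_range_iff hA.injective |>.1 (hA.range_eq ▸ S.finite_points)

theorem len_eq_edist {u v : V} (h : G.graph.Adj u v) :
    (G.len s(u, v) : ℝ≥0∞) = edist (pos u) (pos v) := by
  rw [edist_nndist, ENNReal.coe_inj, ← NNReal.coe_inj, hA.len_eq u v h, coe_nndist]

theorem eq_or_eq_of_mem_segment {x y w : V} (hxy : x = y ∨ G.graph.Adj x y)
    (hw : pos w ∈ segment ℝ (pos x) (pos y)) : w = x ∨ w = y := by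
  obtain rfl | hxy := hxy
  · rw [segment_same] at hw
    exact .inl (hA.injective hw)
  · by_contra! hne
    exact ((hA.adj_iff x y).1 hxy).2.2 w
      ⟨mem_segment_iff_wbtw.1 hw, hA.injective.ne hne.1, hA.injective.ne hne.2⟩

theorem exists_line_of_mem_edge {x y : V} (hxy : x = y ∨ G.graph.Adj x y) {z : Plane}
    (hz : z ∉ S.points) (hzxy : z ∈ segment ℝ (pos x) (pos y)) :
    ∃ s ∈ S.lines, pos x ∈ segment ℝ s.1 s.2 ∧ pos y ∈ segment ℝ s.1 s.2 := by
  obtain rfl | hxy := hxy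
  · rw [segment_same] at hzxy
    exact absurd (hzxy ▸ hA.pos_mem_points x) hz
  · exact ((hA.adj_iff x y).1 hxy).2.1

theorem exists_common_end {x x' y y' : V} (hx : x = x' ∨ G.graph.Adj x x')
    (hy : y = y' ∨ G.graph.Adj y y') {z : Plane} (hzx : z ∈ segment ℝ (pos x) (pos x'))
    (hzy : z ∈ segment ℝ (pos y) (pos y')) : ∃ w, (w = x ∨ w = x') ∧ (w = y ∨ w = y') := by
  by_cases hz : z ∈ S.points
  · obtain ⟨w, rfl⟩ := hA.range_eq.symm ▸ hz
    exact ⟨w, hA.eq_or_eq_of_mem_segment hx hzx, hA.eq_or_eq_of_mem_segment hy hzy⟩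
  obtain ⟨s, hs, hxs, hxs'⟩ := hA.exists_line_of_mem_edge hx hz hzx
  obtain ⟨t, ht, hyt, hyt'⟩ := hA.exists_line_of_mem_edge hy hz hzy
  obtain rfl : s = t := by
    by_contra hst
    exact hz <| .inr ⟨s, hs, t, ht, hst, (convex_segment _ _).segment_subset hxs hxs' hzx,
      (convex_segment _ _).segment_subset hyt hyt' hzy⟩
  obtain h | h | h | h := exists_end_mem_segment (fst_ne_snd hs) hxs hxs' hyt hyt' hzx hzy
  · exact ⟨x, .inl rfl, hA.eq_or_eq_of_mem_segment hy h⟩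
  · exact ⟨x', .inr rfl, hA.eq_or_eq_of_mem_segment hy h⟩
  · exact ⟨y, hA.eq_or_eq_of_mem_segment hx h, .inl rfl⟩
  · exact ⟨y', hA.eq_or_eq_of_mem_segment hx h, .inr rfl⟩

theorem inter_nonempty_of_inter_straightLineDrawing_nonempty {X Y : Set V}
    (h : (straightLineDrawing G.graph pos X ∩ straightLineDrawing G.graph pos Y).Nonempty) :
    (X ∩ Y).Nonempty := by
  obtain ⟨z, ⟨x, hx, x', hx', hxx', hzx⟩, y, hy, y', hy', hyy', hzy⟩ := h
  obtain ⟨w, rfl | rfl, rfl | rfl⟩ := hA.exists_common_end hxx' hyy' hzx hzy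
  exacts [⟨_, hx, hy⟩, ⟨_, hx, hy'⟩, ⟨_, hx', hy⟩, ⟨_, hx', hy'⟩]

theorem straightLineDrawing_subset_unitSquare (X : Set V) :
    straightLineDrawing G.graph pos X ⊆ unitSquare :=
  straightLineDrawing_subset convex_unitSquare fun v _ =>
    points_subset_unitSquare (hA.pos_mem_points v)

theorem inter_nonempty_of_connected {X Y : Set V} (hX : (G.graph.induce X).Connected)
    (hY : (G.graph.induce Y).Connected) {x x' y y' : V} (hx : x ∈ X) (hx' : x' ∈ X) (hy : y ∈ Y)
    (hy' : y' ∈ Y) (hxx' : (pos x, pos x') ∈ S.linesFrom .top)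
    (hyy' : (pos y, pos y') ∈ S.linesFrom .left) : (X ∩ Y).Nonempty := by
  obtain ⟨a, -, b, -, htb⟩ := hxx'
  obtain ⟨c, -, d, -, hlr⟩ := hyy'
  obtain ⟨htop, hbottom⟩ := Prod.mk.inj htb
  obtain ⟨hleft, hright⟩ := Prod.mk.inj hlr
  refine hA.inter_nonempty_of_inter_straightLineDrawing_nonempty <| inter_nonempty_of_joinedIn
    (hA.straightLineDrawing_subset_unitSquare X) (hA.straightLineDrawing_subset_unitSquare Y)
    (by rw [htop]; rfl) (by rw [hbottom]; rfl) (by rw [hleft]; rfl) (by rw [hright]; rfl)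
    (joinedIn_straightLineDrawing hX hx hx') (joinedIn_straightLineDrawing hY hy hy')

section DominatingMinor

variable {V' : Finset V} {G' : LenGraph V'}

theorem exists_walk_support_mem_line (hdom : G.Dominates G') {s : Plane × Plane} (hs : s ∈ S.lines)
    {u v : V'} (huv : G'.d u v = G.d u v) (hu : pos u = s.1) (hv : pos v = s.2) :
    ∃ p : G'.graph.Walk u v, ∀ w ∈ p.support, pos w ∈ segment ℝ s.1 s.2 := by
  have := hA.finite
  have hle : G.d u v ≤ edist (pos u) (pos v) :=
    G.d_le_edist_of_consecutive_adj (convex_segment s.1 s.2)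
      (fun x y hxy hx hy hbtw => (hA.adj_iff x y).2 ⟨hxy, ⟨s, hs, hx, hy⟩, hbtw⟩)
      (fun x y hxy => (hA.len_eq_edist hxy).le) (hu ▸ left_mem_segment ℝ _ _)
      (hv ▸ right_mem_segment ℝ _ _)
  have hge (x y : V') : edist (pos x) (pos y) ≤ G'.d x y :=
    (G.edist_le_d (fun x y hxy => (hA.len_eq_edist hxy).ge) _ _).trans (hdom x y)
  simpa only [hu, hv] using
    G'.exists_walk_support_mem_segment (f := fun w : V' => pos w) hge (huv.trans_le hle)

theorem exists_terminal_branch {B : V' → Set V} (hB : ∀ t ∈ R, ∃ h : t ∈ V', t ∈ B ⟨t, h⟩)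
    {q : Plane} (hq : q ∈ S.terminals) : ∃ v : V', (v : V) ∈ R ∧ (v : V) ∈ B v ∧ pos v = q := by
  obtain ⟨v, hv, rfl⟩ := hA.terminals_eq.symm ▸ hq
  obtain ⟨hv', hvB⟩ := hB v hv
  exact ⟨⟨v, hv'⟩, hv, hvB, rfl⟩

theorem exists_vertex_at_crossing (hG' : G.IsDistPreservingMinor R G') (hdom : G.Dominates G')
    {s t : Plane × Plane} (hs : s ∈ S.linesFrom .top) (ht : t ∈ S.linesFrom .left) :
    ∃ v : V', pos v ∈ segment ℝ s.1 s.2 ∧ pos v ∈ segment ℝ t.1 t.2 := by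
  obtain ⟨⟨B, hconn, hdisj, hadj, hterm⟩, hdist⟩ := hG'
  have hline {s : Plane × Plane} (hs : s ∈ S.lines) : ∃ (u v : V') (p : G'.graph.Walk u v),
      (∀ w ∈ p.support, pos w ∈ segment ℝ s.1 s.2) ∧ (u : V) ∈ B u ∧ (v : V) ∈ B v ∧
      (pos u, pos v) = s := by
    obtain ⟨u, huR, huB, hu⟩ := hA.exists_terminal_branch hterm (fst_mem_terminals hs)
    obtain ⟨v, hvR, hvB, hv⟩ := hA.exists_terminal_branch hterm (snd_mem_terminals hs)
    obtain ⟨p, hp⟩ := hA.exists_walk_support_mem_line hdom hs (hdist u v huR hvR) hu hv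
    exact ⟨u, v, p, hp, huB, hvB, Prod.ext hu hv⟩
  obtain ⟨u, v, p, hp, hu, hv, huv⟩ := hline (.inl hs)
  obtain ⟨u', v', p', hp', hu', hv', huv'⟩ := hline (.inr ht)
  obtain ⟨x, hx, hx'⟩ := hA.inter_nonempty_of_connected
    (connected_induce_iUnion_branchSets hconn hadj p)
    (connected_induce_iUnion_branchSets hconn hadj p')
    (Set.mem_biUnion p.start_mem_support hu) (Set.mem_biUnion p.end_mem_support hv)
    (Set.mem_biUnion p'.start_mem_support hu') (Set.mem_biUnion p'.end_mem_support hv')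
    (huv ▸ hs) (huv' ▸ ht)
  obtain ⟨w, hw, hxw⟩ := Set.mem_iUnion₂.1 hx
  obtain ⟨w', hw', hxw'⟩ := Set.mem_iUnion₂.1 hx'
  obtain rfl : w = w' := by
    by_contra hne
    exact Set.disjoint_left.1 (hdisj w w' hne) hxw hxw'
  exact ⟨w, hp w hw, hp' w hw'⟩

theorem ncard_mul_ncard_le_card (hS : S.GeneralPosition) (hG' : G.IsDistPreservingMinor R G')
    (hdom : G.Dominates G') :
    (S.linesFrom .top).ncard * (S.linesFrom .left).ncard ≤ V'.card := by
  choose f hfst hfsnd using fun c : S.linesFrom .top × S.linesFrom .left =>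
    hA.exists_vertex_at_crossing hG' hdom c.1.2 c.2.2
  have hinj : Function.Injective f := by
    intro c c' h
    obtain ⟨hs, ht⟩ := hS.eq_of_mem_crossings c.1.2 c'.1.2 c.2.2 c'.2.2 (hfst c) (h ▸ hfst c')
      (hfsnd c) (h ▸ hfsnd c')
    exact Prod.ext (Subtype.ext hs) (Subtype.ext ht)
  simpa only [Nat.card_prod, Nat.card_coe_set_eq, Nat.card_eq_fintype_card, Fintype.card_coe]
    using Nat.card_le_card_of_injective f hinj

theorem pow_four_le_card (hS : S.GeneralPosition) (hG' : G.IsDistPreservingMinor R G')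
    (hdom : G.Dominates G') {m : ℕ} (hm : ∀ i, m ≤ (S.side i).card) : m ^ 4 ≤ V'.card :=
  calc m ^ 4 = m * m * (m * m) := by ring
    _ ≤ (S.linesFrom .top).ncard * (S.linesFrom .left).ncard := by
      simp only [ncard_linesFrom]
      gcongr <;> apply hm
    _ ≤ V'.card := hA.ncard_mul_ncard_le_card hS hG' hdom

end DominatingMinor

end IsArrangement

end SquareSides

theorem LenGraph.IsMinor.card_le_card {V : Type*} {G : LenGraph V} {R V' : Finset V}
    {G' : LenGraph V'} (h : G.IsMinor R G') : R.card ≤ V'.card := by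
  obtain ⟨B, -, -, -, hterm⟩ := h
  exact Finset.card_le_card fun t ht => (hterm t ht).1

theorem pow_four_div_le_of_div_four_pow_four_le {k n : ℕ} (hkn : k ≤ n) (h : (k / 4) ^ 4 ≤ n) :
    1 / 4096 * (k : ℝ) ^ 4 ≤ n := by
  obtain hk | hk := lt_or_ge k 4
  · have hk4 : (k : ℝ) ≤ 4 := mod_cast hk.le
    calc 1 / 4096 * (k : ℝ) ^ 4 = 1 / 4096 * ((k : ℝ) ^ 3 * k) := by ring
      _ ≤ 1 / 4096 * ((4 : ℝ) ^ 3 * k) := by gcongr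
      _ ≤ k := by linarith [(Nat.cast_nonneg k : (0 : ℝ) ≤ k)]
      _ ≤ n := mod_cast hkn
  · have hk8 : (k : ℝ) / 8 ≤ (k / 4 : ℕ) := by
      rw [div_le_iff₀ (by norm_num)]
      exact_mod_cast (by omega : k ≤ k / 4 * 8)
    calc 1 / 4096 * (k : ℝ) ^ 4 = ((k : ℝ) / 8) ^ 4 := by ring
      _ ≤ ((k / 4 : ℕ) : ℝ) ^ 4 := by gcongr
      _ ≤ n := mod_cast h

theorem mainTheorem4 :
    ∃ c : ℝ, 0 < c ∧ ∀ k : ℕ, ∃ (V : Type) (_ : Fintype V) (G : LenGraph V) (R : Finset V),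
      R.card = k ∧ IsGenericSquareArrangement G R ∧
      ∀ (V' : Finset V) (G' : LenGraph V'),
        G.IsDistPreservingMinor R G' → G.Dominates G' → c * (k : ℝ) ^ 4 ≤ (V'.card : ℝ) := by
  refine ⟨1 / 4096, by norm_num, fun k => ?_⟩
  obtain ⟨S, hS, hcard⟩ := SquareSides.exists_generalPosition fun
    | .top => k - 3 * (k / 4)
    | _ => k / 4
  have hA := S.isArrangement_arrangement
  have hR : S.terminalPoints.card = k := by
    rw [hA.card_eq_sum, SquareSides.Side.sum_univ]
    simp only [hcard]
    omega
  have hside (i) : k / 4 ≤ (S.side i).card := by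
    rw [hcard]
    cases i <;> dsimp only <;> omega
  refine ⟨S.points, S.finite_points.fintype, S.arrangement, S.terminalPoints, hR,
    ⟨S, Subtype.val, hA, hS, ?_⟩, fun V' G' hG' hdom => ?_⟩
  · rw [hR]
    exact ⟨hside .top, hside .bottom, hside .left, hside .right⟩
  · exact pow_four_div_le_of_div_four_pow_four_le (hR ▸ hG'.1.card_le_card)
      (hA.pow_four_le_card hS hG' hdom hside)
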